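/- Let $\zeta$ be the Riemann zeta function, let $\sigma_0>1$ be a real number and let $n\in\mathbb{N}$. Then there exists a relatively dense set of real numbers $\{t_{n,m}\}_{m\ge 1}$ (that is, there is $L>0$ such that every interval of length $L$ in $\mathbb{R}$ contains at least one of the numbers $t_{n,m}$) such that, for each $m=1,2,\ldots$, the parametrized curve in the plane $$\sigma\mapsto\bigl(\operatorname{Re}\zeta(\sigma+it_{n,m}),\ \operatorname{Im}\zeta(\sigma+it_{n,m})\bigr),\qquad \sigma\in(1,\sigma_0),$$ makes at least $n$ turns around the origin. Here a continuous curve $\gamma\colon(1,\sigma_0)\to\mathbb{C}\setminus\{0\}$ is said to make at least $n$ turns around the origin if, for a continuous function $\varphi\colon(1,\sigma_0)\to\mathbb{R}$ with $\gamma(\sigma)=|\gamma(\sigma)|e^{i\varphi(\sigma)}$ for every $\sigma$ (such a $\varphi$ is unique up to an additive constant in $2\pi\mathbb{Z}$), there are $a,b\in(1,\sigma_0)$ with $|\varphi(b)-\varphi(a)|\ge 2\pi n$. -/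

import Mathlib

/-- A set `T` of real numbers is relatively dense (in the sense of Bohr) if there is a length
`L > 0` such that every interval of length `L` contains at least one element of `T`. -/
def IsRelativelyDense (T : Set ℝ) : Prop :=
  ∃ L : ℝ, 0 < L ∧ ∀ a : ℝ, (T ∩ Set.Icc a (a + L)).Nonempty

/-- `φ` is a continuous determination of the argument, on the parameter set `I`, of the
parametrized curve `γ` (which avoids the origin on `I`). -/
structure IsContinuousArgOn (γ : ℝ → ℂ) (I : Set ℝ) (φ : ℝ → ℝ) : Prop where
  continuousOn : ContinuousOn φ I
  ne_zero : ∀ σ ∈ I, γ σ ≠ 0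
  polar : ∀ σ ∈ I, γ σ = (‖γ σ‖ : ℂ) * Complex.exp ((φ σ : ℂ) * Complex.I)

/-- The parametrized curve `γ`, with parameter in the interval `I`, is continuous, avoids the
origin and makes at least `n` turns around it: between two of its parameters, a continuous
determination of its argument changes (in total, with sign) by at least `2πn` in absolute value.
On an interval the determination is unique up to an additive constant in `2πℤ`. -/
def MakesAtLeastTurns (γ : ℝ → ℂ) (I : Set ℝ) (n : ℕ) : Prop :=
  ContinuousOn γ I ∧ ∃ φ : ℝ → ℝ, IsContinuousArgOn γ I φ ∧
    ∃ a ∈ I, ∃ b ∈ I, 2 * Real.pi * (n : ℝ) ≤ |φ b - φ a|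

/-!
The determination of the argument of `ζ(σ + it)` on `σ > 1` supplied by the Euler product is the
imaginary part of `∑ₚ -log (1 - p^{-s})`. At a fixed abscissa `b > 1` it is bounded uniformly in
`t`, so it suffices to make it large at some abscissa `a ∈ (1, b)`, for a relatively dense set of
`t`. Up to the bounded contribution of the prime powers, it is `-∑ₚ p^{-a} sin (t log p)`.

To find such `t` one does not need Kronecker's theorem: for a finite set `P` of primes, average
`-∑_{p ∈ P} p^{-a} sin (t log p)` against the Riesz product
`K(t) = ∏_{p ∈ P} (1 - sin (t log p)) ≥ 0`. Both `K` and its product with the sum are trigonometric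
polynomials whose frequencies are integer combinations of the `log p`, and these are linearly
independent over `ℤ` by unique factorization. Hence the integrals of these two functions over
`[x, x + L]` are `L` and `(L / 2) ∑_{p ∈ P} p^{-a}` up to an error bounded uniformly in `x` and `L`.
So every interval of a certain length contains a `t` at which the sum exceeds any given number
below `½ ∑_{p ∈ P} p^{-a}` (`exists_length_forall_exists_lt_sum_neg_sin`). As `∑ₚ 1/p` diverges,
this bound is arbitrarily large when `a` is close to `1` and `P` is large.
-/

open Complex

/-! ### Uniform means of trigonometric polynomials -/

/-- `g` is continuous and has mean value `c` on the real line, in the strong sense that its integral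
over an interval of length `L` differs from `c * L` by a bounded amount, uniformly in the position
and the length of the interval. -/
def HasUniformMean (g : ℝ → ℂ) (c : ℂ) : Prop :=
  Continuous g ∧ ∃ C : ℝ, ∀ x L : ℝ, ‖(∫ t in x..x + L, g t) - c * L‖ ≤ C

lemma HasUniformMean.const_mul {g : ℝ → ℂ} {c : ℂ} (h : HasUniformMean g c) (k : ℂ) :
    HasUniformMean (fun t => k * g t) (k * c) := by
  obtain ⟨hg, C, hC⟩ := h
  refine ⟨by fun_prop, ‖k‖ * C, fun x L => ?_⟩
  rw [intervalIntegral.integral_const_mul, mul_assoc, ← mul_sub, norm_mul]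
  exact mul_le_mul_of_nonneg_left (hC x L) (norm_nonneg k)

lemma HasUniformMean.add {g g' : ℝ → ℂ} {c c' : ℂ} (h : HasUniformMean g c)
    (h' : HasUniformMean g' c') : HasUniformMean (fun t => g t + g' t) (c + c') := by
  obtain ⟨hg, C, hC⟩ := h
  obtain ⟨hg', C', hC'⟩ := h'
  refine ⟨hg.add hg', C + C', fun x L => ?_⟩
  rw [intervalIntegral.integral_add (hg.intervalIntegrable _ _) (hg'.intervalIntegrable _ _),
    add_mul, add_sub_add_comm]
  exact norm_add_le_of_le (hC x L) (hC' x L)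

lemma HasUniformMean.sum {ι : Type*} {g : ι → ℝ → ℂ} {c : ι → ℂ} (s : Finset ι)
    (h : ∀ i ∈ s, HasUniformMean (g i) (c i)) :
    HasUniformMean (fun t => ∑ i ∈ s, g i t) (∑ i ∈ s, c i) := by
  choose! hg C hC using h
  refine ⟨continuous_finsetSum _ fun i hi => hg i hi, ∑ i ∈ s, C i, fun x L => ?_⟩
  rw [intervalIntegral.integral_finsetSum fun i hi => (hg i hi).intervalIntegrable _ _,
    Finset.sum_mul, ← Finset.sum_sub_distrib]
  exact norm_sum_le_of_le _ fun i hi => hC i hi x L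

lemma HasUniformMean.exp_mul_I (ω : ℝ) :
    HasUniformMean (fun t => exp ((t * ω : ℝ) * I)) (if ω = 0 then 1 else 0) := by
  refine ⟨by fun_prop, ?_⟩
  split_ifs with hω
  · exact ⟨0, fun x L => by simp [hω]⟩
  · refine ⟨2 / |ω|, fun x L => ?_⟩
    have hc : (ω : ℂ) * I ≠ 0 := by simp [hω]
    have hrw : (fun t : ℝ => exp ((t * ω : ℝ) * I)) = fun t : ℝ => exp ((ω : ℂ) * I * t) := by
      funext t; congr 1; push_cast; ring
    have hnorm : ∀ t : ℝ, ‖exp ((ω : ℂ) * I * t)‖ = 1 := fun t => by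
      rw [show (ω : ℂ) * I * t = (ω * t : ℝ) * I by push_cast; ring, norm_exp_ofReal_mul_I]
    rw [hrw, integral_exp_mul_complex hc, zero_mul, sub_zero, norm_div]
    have hden : ‖(ω : ℂ) * I‖ = |ω| := by simp
    rw [hden]
    gcongr
    refine (norm_sub_le _ _).trans ?_
    rw [hnorm, hnorm]; norm_num

/-! ### Linear independence of the logarithms of the primes -/

lemma padicValRat_prod {ι : Type*} (p : ℕ) [Fact p.Prime] (s : Finset ι) (f : ι → ℚ)
    (hf : ∀ i ∈ s, f i ≠ 0) : padicValRat p (∏ i ∈ s, f i) = ∑ i ∈ s, padicValRat p (f i) := by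
  classical
  induction s using Finset.induction with
  | empty => simp
  | insert i s hi ih =>
    rw [Finset.prod_insert hi, Finset.sum_insert hi,
      padicValRat.mul (hf i (Finset.mem_insert_self i s))
        (Finset.prod_ne_zero_iff.2 fun j hj => hf j (Finset.mem_insert_of_mem hj)),
      ih fun j hj => hf j (Finset.mem_insert_of_mem hj)]

lemma eq_zero_of_sum_mul_log_primes_eq_zero (s : Finset Nat.Primes) (e : Nat.Primes → ℤ)
    (h : ∑ p ∈ s, (e p : ℝ) * Real.log p = 0) : ∀ p ∈ s, e p = 0 := by
  intro p hp
  have hpos : ∀ q : Nat.Primes, (0 : ℝ) < (q : ℕ) := fun q => by exact_mod_cast q.2.pos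
  have hne : ∀ q : Nat.Primes, ((q : ℕ) : ℚ) ≠ 0 := fun q => by exact_mod_cast q.2.ne_zero
  have h1 : ∏ q ∈ s, ((q : ℕ) : ℝ) ^ e q = 1 := by
    refine Real.eq_one_of_pos_of_log_eq_zero
      (Finset.prod_pos fun q _ => zpow_pos (hpos q) _) ?_
    rw [Real.log_prod fun q _ => (zpow_pos (hpos q) _).ne', ← h]
    exact Finset.sum_congr rfl fun q _ => Real.log_zpow _ _
  have h2 : ∏ q ∈ s, ((q : ℕ) : ℚ) ^ e q = 1 := by
    apply Rat.cast_injective (α := ℝ)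
    push_cast
    exact h1
  have : Fact (p : ℕ).Prime := ⟨p.2⟩
  have h3 := congrArg (padicValRat p) h2
  rw [padicValRat_prod _ _ _ fun q _ => zpow_ne_zero _ (hne q), padicValRat.one,
    Finset.sum_eq_single_of_mem p hp] at h3
  · simpa [padicValRat.zpow, hne p] using h3
  · intro q _ hqp
    have : Fact (q : ℕ).Prime := ⟨q.2⟩
    have : padicValNat p q = 0 :=
      padicValNat_primes fun hpq => hqp (Subtype.ext hpq.symm)
    simp [padicValRat.zpow, padicValRat.of_nat, this]

/-- Different primes oscillate independently: the mean of a product, over distinct primes `p`, of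
trigonometric polynomials in `t log p` is the product of their constant terms. -/
lemma hasUniformMean_prod_primes (P : Finset Nat.Primes) (J : Finset ℤ) (hJ : 0 ∈ J)
    (c : Nat.Primes → ℤ → ℂ) :
    HasUniformMean (fun t => ∏ p ∈ P, ∑ k ∈ J, c p k * exp ((k * (t * Real.log p) : ℝ) * I))
      (∏ p ∈ P, c p 0) := by
  classical
  have key := HasUniformMean.sum (Fintype.piFinset fun _ : P => J) fun e _ =>
    (HasUniformMean.exp_mul_I (∑ p : P, (e p : ℝ) * Real.log p)).const_mul (∏ p : P, c p (e p))
  convert key using 1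
  · funext t
    rw [← Finset.prod_coe_sort, Finset.prod_univ_sum]
    refine Finset.sum_congr rfl fun e _ => ?_
    rw [Finset.prod_mul_distrib, ← Complex.exp_sum]
    congr 2
    push_cast
    rw [Finset.mul_sum, Finset.sum_mul]
    exact Finset.sum_congr rfl fun p _ => by ring
  · rw [Finset.sum_eq_single (fun _ => 0)]
    · simp [Finset.prod_attach P fun p => c p 0]
    · intro e _ he
      rw [if_neg, mul_zero]
      intro h0
      refine he (funext fun p => ?_)
      have := eq_zero_of_sum_mul_log_primes_eq_zero P
        (fun q => if hq : q ∈ P then e ⟨q, hq⟩ else 0) (by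
          rw [← Finset.sum_coe_sort, ← h0]
          exact Finset.sum_congr rfl fun q _ => by simp) p p.2
      simpa using this
    · intro h
      exact absurd (Fintype.mem_piFinset.2 fun _ => hJ) h

/-! ### The Riesz product -/

/-- The Riesz product `∏ (1 - sin (t log p))` over a finite set of primes. -/
noncomputable def rieszProduct (P : Finset Nat.Primes) (t : ℝ) : ℝ :=
  ∏ p ∈ P, (1 - Real.sin (t * Real.log p))

lemma rieszProduct_nonneg (P : Finset Nat.Primes) (t : ℝ) : 0 ≤ rieszProduct P t :=
  Finset.prod_nonneg fun _ _ => sub_nonneg.2 (Real.sin_le_one _)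

lemma hasUniformMean_rieszProduct (P : Finset Nat.Primes) :
    HasUniformMean (fun t => rieszProduct P t) 1 := by
  convert hasUniformMean_prod_primes P {0, 1, -1} (by simp)
    (fun _ k => if k = 0 then 1 else if k = 1 then I / 2 else -I / 2) using 1
  · funext t
    rw [rieszProduct, ofReal_prod]
    refine Finset.prod_congr rfl fun p _ => ?_
    rw [Finset.sum_insert (by simp), Finset.sum_insert (by simp), Finset.sum_singleton]
    generalize t * Real.log p = x
    push_cast
    simp [Complex.sin]
    ring
  · simp

/-- The function `-sin (t log p)` resonates with the Riesz product: its mean against it is the mean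
`1 / 2` of `sin²`. -/
lemma hasUniformMean_sin_mul_rieszProduct (P : Finset Nat.Primes) {q : Nat.Primes} (hq : q ∈ P) :
    HasUniformMean (fun t => (-Real.sin (t * Real.log q) * rieszProduct P t : ℝ)) (1 / 2) := by
  classical
  convert hasUniformMean_prod_primes P {0, 1, -1, 2, -2} (by simp)
    (fun p k => if p = q then
        (if k = 0 then 1 / 2 else if k = 1 then I / 2 else if k = -1 then -I / 2 else -1 / 4)
      else if k = 0 then 1 else if k = 1 then I / 2 else if k = -1 then -I / 2 else 0) using 1
  · funext t
    rw [rieszProduct, ← Finset.mul_prod_erase _ _ hq, ← Finset.mul_prod_erase P _ hq,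
      ← mul_assoc, ofReal_mul, ofReal_prod]
    congr 1
    · rw [Finset.sum_insert (by simp), Finset.sum_insert (by simp), Finset.sum_insert (by simp),
        Finset.sum_insert (by simp), Finset.sum_singleton]
      generalize t * Real.log q = x
      have h2 : exp (2 * x * I) = exp (x * I) * exp (x * I) := by rw [← Complex.exp_add]; ring_nf
      have h3 : exp (-(2 * x * I)) = exp (-(x * I)) * exp (-(x * I)) := by
        rw [← Complex.exp_add]; ring_nf
      have h4 : exp (x * I) * exp (-(x * I)) = 1 := by rw [← Complex.exp_add]; simp
      push_cast
      simp [Complex.sin, h2, h3]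
      linear_combination (1 / 2 : ℂ) * h4 + (1 / 4 : ℂ) * (exp (x * I) - exp (-(x * I))) ^ 2 * I_sq
    · refine Finset.prod_congr rfl fun p hp => ?_
      rw [Finset.sum_insert (by simp), Finset.sum_insert (by simp), Finset.sum_insert (by simp),
        Finset.sum_insert (by simp), Finset.sum_singleton]
      generalize t * Real.log p = x
      push_cast
      simp [Complex.sin, Finset.ne_of_mem_erase hp]
      ring
  · simp [Finset.prod_ite_eq', hq]

/-- Averaging against the Riesz product over an arbitrary interval of a fixed, sufficiently large
length produces a point where a weighted sum of `-sin (t log p)` exceeds any number smaller than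
half of its total weight. -/
lemma exists_length_forall_exists_lt_sum_neg_sin (P : Finset Nat.Primes) (w : Nat.Primes → ℝ)
    (B : ℝ) (hB : B < (∑ p ∈ P, w p) / 2) :
    ∃ L : ℝ, 0 < L ∧ ∀ x : ℝ, ∃ t ∈ Set.Icc x (x + L),
      B < ∑ p ∈ P, w p * -Real.sin (t * Real.log p) := by
  -- If the sum were at most `B` on a long interval, the integral of the following function over it
  -- would be nonpositive, although its mean is positive.
  have h : HasUniformMean
      (fun t => ((∑ p ∈ P, w p * -Real.sin (t * Real.log p) - B) * rieszProduct P t : ℝ))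
      (((∑ p ∈ P, w p) / 2 - B : ℝ)) := by
    have h1 := HasUniformMean.sum P fun p hp =>
      (hasUniformMean_sin_mul_rieszProduct P hp).const_mul (w p)
    have h2 := (hasUniformMean_rieszProduct P).const_mul (-B)
    convert h1.add h2 using 1
    · funext t
      push_cast
      rw [sub_mul, Finset.sum_mul, sub_eq_add_neg, neg_mul]
      congr 1
      exact Finset.sum_congr rfl fun p _ => by ring
    · push_cast
      rw [← Finset.sum_mul]
      ring
  obtain ⟨-, C, hC⟩ := h
  set d : ℝ := (∑ p ∈ P, w p) / 2 - B with hd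
  have hd0 : 0 < d := sub_pos.2 hB
  have hC0 : 0 ≤ C := (norm_nonneg _).trans (hC 0 0)
  refine ⟨(C + 1) / d, by positivity, fun x => ?_⟩
  by_contra! hcon
  have hL := hC x ((C + 1) / d)
  rw [intervalIntegral.integral_ofReal, ← ofReal_mul, ← ofReal_sub, norm_real, Real.norm_eq_abs,
    mul_div_cancel₀ _ hd0.ne', abs_le] at hL
  have hle : ∫ t in x..x + (C + 1) / d,
      (∑ p ∈ P, w p * -Real.sin (t * Real.log p) - B) * rieszProduct P t ≤ 0 := by
    rw [← neg_nonneg, ← intervalIntegral.integral_neg]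
    refine intervalIntegral.integral_nonneg (by rw [le_add_iff_nonneg_right]; positivity)
      fun t ht => neg_nonneg.2 ?_
    exact mul_nonpos_of_nonpos_of_nonneg (sub_nonpos.2 (hcon t ht)) (rieszProduct_nonneg P t)
  linarith [hL.1]

/-! ### The logarithm of the zeta function -/

/-- The logarithm `∑ₚ -log (1 - p^{-s})` of `ζ` on `Re s > 1` given by the Euler product. -/
noncomputable def logZeta (s : ℂ) : ℂ := ∑' p : Nat.Primes, -log (1 - (p : ℂ) ^ (-s))

lemma norm_primes_cpow_neg (p : Nat.Primes) (s : ℂ) :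
    ‖((p : ℕ) : ℂ) ^ (-s)‖ = ((p : ℕ) : ℝ) ^ (-s.re) := by
  rw [norm_natCast_cpow_of_pos p.2.pos, neg_re]

lemma primes_rpow_neg_le_half (p : Nat.Primes) {x : ℝ} (hx : 1 ≤ x) :
    ((p : ℕ) : ℝ) ^ (-x) ≤ 1 / 2 := by
  have h2 : (2 : ℝ) ≤ (p : ℕ) := by exact_mod_cast p.2.two_le
  calc ((p : ℕ) : ℝ) ^ (-x) ≤ ((p : ℕ) : ℝ) ^ (-1 : ℝ) :=
        Real.rpow_le_rpow_of_exponent_le (by linarith) (by linarith)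
    _ ≤ 1 / 2 := by
        rw [Real.rpow_neg_one, one_div]
        exact inv_anti₀ two_pos h2

lemma summable_primes_rpow_neg {x : ℝ} (hx : 1 < x) :
    Summable fun p : Nat.Primes => ((p : ℕ) : ℝ) ^ (-x) :=
  Nat.Primes.summable_rpow.2 (by linarith)

lemma norm_neg_log_one_sub_primes_cpow_le (p : Nat.Primes) {s : ℂ} (hs : 1 ≤ s.re) :
    ‖-log (1 - (p : ℂ) ^ (-s))‖ ≤ 3 / 2 * ((p : ℕ) : ℝ) ^ (-s.re) := by
  have h := norm_log_one_add_half_le_self (z := -((p : ℕ) : ℂ) ^ (-s))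
    (by rw [norm_neg, norm_primes_cpow_neg]; exact primes_rpow_neg_le_half p hs)
  rwa [norm_neg, norm_primes_cpow_neg, ← sub_eq_add_neg, ← norm_neg] at h

/-- The terms of order at least two of the series of `-log (1 - p^{-s})` contribute at most
`p^{-2}`. -/
lemma norm_neg_log_one_sub_primes_cpow_sub_le (p : Nat.Primes) {s : ℂ} (hs : 1 ≤ s.re) :
    ‖-log (1 - (p : ℂ) ^ (-s)) - (p : ℂ) ^ (-s)‖ ≤ ((p : ℕ) : ℝ) ^ (-2 : ℝ) := by
  set z : ℂ := ((p : ℕ) : ℂ) ^ (-s) with hz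
  have hz2 : ‖z‖ ≤ 1 / 2 := by rw [norm_primes_cpow_neg]; exact primes_rpow_neg_le_half p hs
  have hp1 : (1 : ℝ) ≤ (p : ℕ) := by exact_mod_cast p.2.one_lt.le
  have h := norm_log_one_add_sub_self_le (z := -z) (by rw [norm_neg]; linarith)
  rw [norm_neg, ← sub_eq_add_neg] at h
  have hinv : (1 - ‖z‖)⁻¹ ≤ 2 := by
    rw [inv_le_comm₀ (by linarith) two_pos]; linarith
  calc ‖-log (1 - z) - z‖ = ‖log (1 - z) - -z‖ := by rw [← norm_neg]; congr 1; ring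
    _ ≤ ‖z‖ ^ 2 * (1 - ‖z‖)⁻¹ / 2 := h
    _ ≤ ‖z‖ ^ 2 := by nlinarith [sq_nonneg ‖z‖]
    _ = ((p : ℕ) : ℝ) ^ (-s.re * 2) := by
        rw [norm_primes_cpow_neg, ← Real.rpow_natCast, ← Real.rpow_mul (by linarith)]; norm_num
    _ ≤ ((p : ℕ) : ℝ) ^ (-2 : ℝ) := Real.rpow_le_rpow_of_exponent_le hp1 (by linarith)

lemma summable_neg_log_one_sub_primes_cpow {s : ℂ} (hs : 1 < s.re) :
    Summable fun p : Nat.Primes => -log (1 - (p : ℂ) ^ (-s)) :=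
  ((summable_primes_rpow_neg hs).mul_left (3 / 2)).of_norm_bounded fun p =>
    norm_neg_log_one_sub_primes_cpow_le p hs.le

lemma norm_logZeta_le {s : ℂ} (hs : 1 < s.re) :
    ‖logZeta s‖ ≤ 3 / 2 * ∑' p : Nat.Primes, ((p : ℕ) : ℝ) ^ (-s.re) := by
  rw [← tsum_mul_left]
  exact tsum_of_norm_bounded ((summable_primes_rpow_neg hs).mul_left (3 / 2)).hasSum fun p =>
    norm_neg_log_one_sub_primes_cpow_le p hs.le

lemma continuousOn_logZeta : ContinuousOn logZeta {s : ℂ | 1 < s.re} := by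
  intro s hs
  -- The series converges uniformly on a closed half-plane that is a neighbourhood of `s`.
  obtain ⟨x, hx1, hxs⟩ := exists_between (show 1 < s.re from hs)
  have hcont : ContinuousOn logZeta {s : ℂ | x < s.re} := by
    refine continuousOn_tsum (u := fun p : Nat.Primes => 3 / 2 * ((p : ℕ) : ℝ) ^ (-x))
      (fun p => ?_) ((summable_primes_rpow_neg hx1).mul_left _) fun p s hs => ?_
    · have hp : ((p : ℕ) : ℂ) ≠ 0 := by exact_mod_cast p.2.ne_zero
      refine (ContinuousOn.clog ?_ fun s hs => ?_).neg
      · exact (continuous_const.sub (continuous_neg.const_cpow (Or.inl hp))).continuousOn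
      · rw [sub_eq_add_neg]
        refine mem_slitPlane_of_norm_lt_one ?_
        rw [norm_neg, norm_primes_cpow_neg]
        exact (primes_rpow_neg_le_half p (hx1.trans hs).le).trans_lt (by norm_num)
    · refine (norm_neg_log_one_sub_primes_cpow_le p (hx1.trans hs).le).trans ?_
      have hp1 : (1 : ℝ) ≤ (p : ℕ) := by exact_mod_cast p.2.one_lt.le
      have : x < s.re := hs
      gcongr
  exact (hcont.continuousAt
    ((isOpen_lt continuous_const continuous_re).mem_nhds hxs)).continuousWithinAt

lemma im_primes_cpow_neg (p : Nat.Primes) (σ t : ℝ) :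
    (((p : ℕ) : ℂ) ^ (-((σ : ℂ) + t * I))).im =
      ((p : ℕ) : ℝ) ^ (-σ) * -Real.sin (t * Real.log p) := by
  have hp : (0 : ℝ) < (p : ℕ) := by exact_mod_cast p.2.pos
  have hp' : ((p : ℕ) : ℂ) ≠ 0 := by exact_mod_cast p.2.ne_zero
  rw [cpow_def_of_ne_zero hp', exp_im, ← natCast_log]
  have hexp : (Real.log p : ℂ) * -((σ : ℂ) + t * I) =
      ((Real.log p * -σ : ℝ) : ℂ) + ((-(t * Real.log p) : ℝ) : ℂ) * I := by
    push_cast; ring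
  rw [hexp, add_re, add_im, ofReal_re, ofReal_im, re_ofReal_mul, im_ofReal_mul, I_re, I_im,
    mul_zero, mul_one, add_zero, zero_add, ← Real.rpow_def_of_pos hp, Real.sin_neg]

/-- Up to the bounded contribution of the prime powers and the tail `∑_{p ∉ P} p^{-σ}`, the argument
of `ζ(σ + it)` is at least the finite sum `-∑_{p ∈ P} p^{-σ} sin (t log p)`. -/
lemma sum_neg_sin_le_im_logZeta (P : Finset Nat.Primes) {σ : ℝ} (hσ : 1 < σ) (t : ℝ) :
    ∑ p ∈ P, ((p : ℕ) : ℝ) ^ (-σ) * -Real.sin (t * Real.log p) ≤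
      (logZeta (σ + t * I)).im + ∑' p : Nat.Primes, ((p : ℕ) : ℝ) ^ (-2 : ℝ) +
        (∑' p : Nat.Primes, ((p : ℕ) : ℝ) ^ (-σ) - ∑ p ∈ P, ((p : ℕ) : ℝ) ^ (-σ)) := by
  have hs : ((σ : ℂ) + t * I).re = σ := by simp
  have hs1 : 1 < ((σ : ℂ) + t * I).re := by rwa [hs]
  have hsum := summable_neg_log_one_sub_primes_cpow hs1
  have hS2 : Summable fun p : Nat.Primes => ((p : ℕ) : ℝ) ^ (-2 : ℝ) :=
    summable_primes_rpow_neg one_lt_two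
  have hSσ := summable_primes_rpow_neg hσ
  have him : Summable fun p : Nat.Primes => (-log (1 - (p : ℂ) ^ (-((σ : ℂ) + t * I)))).im :=
    (hasSum_im hsum.hasSum).summable
  have hlow : ∀ p : Nat.Primes, ((p : ℕ) : ℝ) ^ (-σ) * -Real.sin (t * Real.log p) ≤
      (-log (1 - (p : ℂ) ^ (-((σ : ℂ) + t * I)))).im + ((p : ℕ) : ℝ) ^ (-2 : ℝ) := fun p => by
    have h := (abs_im_le_norm _).trans (norm_neg_log_one_sub_primes_cpow_sub_le p hs1.le)
    rw [sub_im, im_primes_cpow_neg] at h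
    linarith [(abs_le.1 h).1]
  have hneg : ∀ p : Nat.Primes, -((p : ℕ) : ℝ) ^ (-σ) ≤
      ((p : ℕ) : ℝ) ^ (-σ) * -Real.sin (t * Real.log p) := fun p => by
    have h0 : (0 : ℝ) ≤ ((p : ℕ) : ℝ) ^ (-σ) := by positivity
    nlinarith [Real.sin_le_one (t * Real.log p)]
  have hfin := ((him.add hS2).add hSσ).sum_le_tsum P fun p _ => by
    linarith [hlow p, hneg p]
  rw [(him.add hS2).tsum_add hSσ, him.tsum_add hS2, ← im_tsum hsum, Finset.sum_add_distrib] at hfin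
  have := Finset.sum_le_sum fun p (_ : p ∈ P) => hlow p
  rw [logZeta]
  linarith

/-- The series `∑ₚ 1/p` diverges, so `∑ₚ p^{-a}` is arbitrarily large as `a` tends to `1`. -/
lemma exists_lt_sum_primes_rpow_neg (M : ℝ) {b : ℝ} (hb : 1 < b) :
    ∃ a ∈ Set.Ioo 1 b, ∃ P : Finset Nat.Primes, M < ∑ p ∈ P, ((p : ℕ) : ℝ) ^ (-a) := by
  obtain ⟨P, hP⟩ : ∃ P : Finset Nat.Primes, M < ∑ p ∈ P, ((p : ℕ) : ℝ) ^ (-(1 : ℝ)) := by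
    by_contra! h
    refine Nat.Primes.not_summable_one_div
      (summable_of_sum_le (c := M) (fun p => by positivity) fun P => ?_)
    simpa [Real.rpow_neg_one] using h P
  have hcont : Continuous fun a : ℝ => ∑ p ∈ P, ((p : ℕ) : ℝ) ^ (-a) :=
    continuous_finsetSum _ fun p _ => continuous_const.rpow continuous_neg fun _ =>
      Or.inl (by exact_mod_cast p.2.ne_zero)
  have hev := (hcont.tendsto 1).eventually_const_lt hP
  have hIoo : ∀ᶠ a in nhdsWithin 1 (Set.Ioi 1), a ∈ Set.Ioo 1 b := Ioo_mem_nhdsGT hb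
  obtain ⟨a, ha, haM⟩ := (hIoo.and (hev.filter_mono nhdsWithin_le_nhds)).exists
  exact ⟨a, ha, P, haM⟩

/-! ### Turns around the origin -/

lemma isContinuousArgOn_im_logZeta (σ₀ t : ℝ) :
    IsContinuousArgOn (fun σ : ℝ => riemannZeta ((σ : ℂ) + (t : ℂ) * I)) (Set.Ioo 1 σ₀)
      (fun σ => (logZeta (σ + t * I)).im) where
  continuousOn := continuous_im.comp_continuousOn
    (continuousOn_logZeta.comp (by fun_prop) fun σ hσ => by simpa using hσ.1)
  ne_zero σ hσ := riemannZeta_ne_zero_of_one_lt_re (by simpa using hσ.1)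
  polar σ hσ := by
    have h : exp (logZeta (σ + t * I)) = riemannZeta (σ + t * I) :=
      riemannZeta_eulerProduct_exp_log (by simpa using hσ.1)
    rw [← h, norm_exp, ofReal_exp, ← Complex.exp_add, re_add_im]

/-- The set of `t` for which the curve makes at least `n` turns is relatively dense. -/
lemma isRelativelyDense_setOf_makesAtLeastTurns (σ₀ : ℝ) (hσ₀ : 1 < σ₀) (n : ℕ) :
    IsRelativelyDense {t : ℝ | MakesAtLeastTurns
      (fun σ : ℝ => riemannZeta ((σ : ℂ) + (t : ℂ) * I)) (Set.Ioo 1 σ₀) n} := by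
  obtain ⟨b, hb1, hb⟩ := exists_between hσ₀
  set S : ℝ → ℝ := fun x => ∑' p : Nat.Primes, ((p : ℕ) : ℝ) ^ (-x) with hS
  -- The argument is bounded by `3 / 2 * S b` at `b`; `S 2` and `1` account for the error terms in
  -- `sum_neg_sin_le_im_logZeta`.
  set M : ℝ := 2 * Real.pi * n + 3 / 2 * S b + S 2 + 1 with hM
  obtain ⟨a, ha, P₀, hP₀⟩ := exists_lt_sum_primes_rpow_neg (2 * M) hb1
  have hsum := summable_primes_rpow_neg ha.1
  obtain ⟨P, hP₀P, hP⟩ : ∃ P : Finset Nat.Primes, P₀ ⊆ P ∧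
      S a - 1 < ∑ p ∈ P, ((p : ℕ) : ℝ) ^ (-a) := by
    obtain ⟨P, h1, h2⟩ := ((Filter.eventually_ge_atTop P₀).and
      (hsum.hasSum.eventually_const_lt (sub_one_lt (S a)))).exists
    exact ⟨P, h1, h2⟩
  have hPM : M < (∑ p ∈ P, ((p : ℕ) : ℝ) ^ (-a)) / 2 := by
    have : ∑ p ∈ P₀, ((p : ℕ) : ℝ) ^ (-a) ≤ ∑ p ∈ P, ((p : ℕ) : ℝ) ^ (-a) :=
      Finset.sum_le_sum_of_subset_of_nonneg hP₀P fun p _ _ => by positivity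
    linarith
  obtain ⟨L, hL, h⟩ := exists_length_forall_exists_lt_sum_neg_sin P _ M hPM
  refine ⟨L, hL, fun x => ?_⟩
  obtain ⟨t, ht, htM⟩ := h x
  refine ⟨t, ⟨?_, ?_⟩, ht⟩
  · intro σ hσ
    have hne : (σ : ℂ) + t * I ≠ 1 := fun h => by
      have := congrArg re h
      simp at this
      exact hσ.1.ne' this
    have h1 : ContinuousAt riemannZeta ((σ : ℂ) + t * I) :=
      (differentiableAt_riemannZeta hne).continuousAt
    have h2 : ContinuousAt (fun σ : ℝ => (σ : ℂ) + t * I) σ := by fun_prop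
    exact (ContinuousAt.comp (f := fun σ : ℝ => (σ : ℂ) + t * I) h1 h2).continuousWithinAt
  · refine ⟨_, isContinuousArgOn_im_logZeta σ₀ t, b, ⟨hb1, hb⟩, a, ⟨ha.1, ha.2.trans hb⟩, ?_⟩
    have h1 := sum_neg_sin_le_im_logZeta P ha.1 t
    have h2 : |(logZeta (b + t * I)).im| ≤ 3 / 2 * S b := by
      refine (abs_im_le_norm _).trans ?_
      simpa using norm_logZeta_le (s := b + t * I) (by simpa using hb1)
    refine le_trans ?_ (le_abs_self _)
    simp only [hS] at *
    linarith [(abs_le.1 h2).2]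

/-- A relatively dense set contains a relatively dense sequence: it suffices to pick a point in each
interval `[kL, (k + 1)L]`, `k ∈ ℤ`. -/
lemma IsRelativelyDense.exists_seq {T : Set ℝ} (hT : IsRelativelyDense T) :
    ∃ t : ℕ → ℝ, IsRelativelyDense (Set.range t) ∧ ∀ m, t m ∈ T := by
  obtain ⟨L, hL, h⟩ := hT
  choose u hu using fun k : ℤ => h (k * L)
  obtain ⟨f, hf⟩ := exists_surjective_nat ℤ
  refine ⟨u ∘ f, ⟨2 * L, by positivity, fun x => ?_⟩, fun m => (hu (f m)).1⟩
  obtain ⟨m, hm⟩ := hf ⌈x / L⌉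
  refine ⟨u ⌈x / L⌉, ⟨m, by simp [hm]⟩, ?_⟩
  have h1 : x ≤ ⌈x / L⌉ * L := (div_le_iff₀ hL).1 (Int.le_ceil _)
  have h2 : ⌈x / L⌉ * L ≤ x + L := by
    have := mul_le_mul_of_nonneg_right (Int.ceil_lt_add_one (x / L)).le hL.le
    rwa [add_mul, div_mul_cancel₀ _ hL.ne', one_mul] at this
  have h3 := (hu ⌈x / L⌉).2
  exact ⟨h1.trans h3.1, by linarith [h3.2]⟩

theorem mainTheorem2 (σ₀ : ℝ) (hσ₀ : 1 < σ₀) (n : ℕ) :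
    ∃ t : ℕ → ℝ, IsRelativelyDense (Set.range t) ∧
      ∀ m : ℕ, MakesAtLeastTurns
        (fun σ : ℝ => riemannZeta ((σ : ℂ) + (t m : ℂ) * Complex.I)) (Set.Ioo 1 σ₀) n :=
  (isRelativelyDense_setOf_makesAtLeastTurns σ₀ hσ₀ n).exists_seq
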